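/- Let $G$ be a finite group, and let $C(G)$ be the set of cyclic subgroups of $G$, partially ordered by inclusion. A breaking point of $C(G)$ is a subgroup $H \in C(G)$ with $H \neq 1$ and $H \neq G$ such that for every $X \in C(G)$ we have $X \leq H$ or $H \leq X$. Then $C(G)$ has at least one breaking point if and only if $G$ is either a cyclic $p$-group of order at least $p^2$ for some prime $p$, or a generalized quaternion $2$-group, i.e. isomorphic, for some natural number $n \geq 3$, to the group of order $2^n$ $$Q_{2^n}=\langle a,b \mid a^{2^{n-2}}= b^2,\ a^{2^{n-1}}=1,\ b^{-1}ab=a^{-1}\rangle.$$ -/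

import Mathlib

/-- The poset `C(G)` of cyclic subgroups of `G`, ordered by inclusion (as a subtype of the
lattice of subgroups of `G`). -/
abbrev CyclicSubgroups (G : Type*) [Group G] : Type _ :=
  {H : Subgroup G // IsCyclic H}

/-- A breaking point of `C(G)`: a cyclic subgroup of `G` that is nontrivial and proper (as a
subgroup of `G`) and comparable with every cyclic subgroup of `G`. -/
def IsBreakingPoint {G : Type*} [Group G] (H : CyclicSubgroups G) : Prop :=
  (H : Subgroup G) ≠ ⊥ ∧ (H : Subgroup G) ≠ ⊤ ∧ ∀ X : CyclicSubgroups G, X ≤ H ∨ H ≤ X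

/-- `G` is a generalized quaternion 2-group, i.e. isomorphic, for some `n ≥ 3`, to
`Q_{2^n} = ⟨a, b | a^(2^(n-2)) = b^2, a^(2^(n-1)) = 1, b⁻¹ a b = a⁻¹⟩`.
Mathlib's `QuaternionGroup m` is the group of order `4 m` generated by `a`, `x` with
`a^(2m) = 1`, `x^2 = a^m`, `x⁻¹ a x = a⁻¹`; here `m = 2^(n-2)`, so that `4 m = 2^n`. -/
def IsGeneralizedQuaternionTwoGroup (G : Type*) [Group G] : Prop :=
  ∃ n : ℕ, 3 ≤ n ∧ Nonempty (G ≃* QuaternionGroup (2 ^ (n - 2)))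

section

open Subgroup Finset

variable {G : Type*} [Group G] {p : ℕ}

/-! A breaking point forces `G` to be a `p`-group whose subgroup of order `p` lies in every
nontrivial cyclic subgroup (`exists_isPGroup_of_forall_notMem`, `mem_zpowers_of_forall_notMem`).
Conversely, such a subgroup is a breaking point once it is proper. What remains is the
classification of `p`-groups with one subgroup of order `p`.

Take a self-centralizing normal `A = zpowers a` containing all elements of order `p`, and `x ∉ A`
with `x ^ p = a ^ j` and `x * a * x⁻¹ = a ^ k`. Self-centralization gives `p ∣ j`. If `1 + k + ⋯ + k
^ (p - 1)` is `p` times a unit mod `p`, some `a ^ i * x` has `p`-th power `1`, which is absurd. This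
excludes odd `p`; for `p = 2` it forces `x` to invert `a`, so `A` has index 2 and `G` is quaternion.
-/

theorem IsPGroup.exists_mem_center_orderOf_eq [Finite G] [Fact p.Prime] (hG : IsPGroup p G)
    (N : Subgroup G) [N.Normal] (hN : N ≠ ⊥) : ∃ q ∈ N, q ∈ center G ∧ orderOf q = p := by
  have hdvd : p ∣ Nat.card N := (hG.to_subgroup N).card_eq_or_dvd.resolve_left
    (mt Subgroup.card_eq_one.mp hN)
  obtain ⟨b, hb, hb1⟩ :=
    (hG.of_equiv ConjAct.toConjAct).exists_fixed_point_of_prime_dvd_card_of_fixed_point N hdvd (a := 1) (fun g => by simp)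
  have hbc : (b : G) ∈ center G := by
    rw [mem_center_iff]
    intro g
    have := congrArg (Subtype.val) (hb (ConjAct.toConjAct g))
    rw [ConjAct.Subgroup.val_conj_smul, ConjAct.toConjAct_smul] at this
    exact mul_inv_eq_iff_eq_mul.mp this
  have hM : (N ⊓ center G) ≠ ⊥ := fun h =>
    hb1 (Subtype.ext ((mem_bot.mp (h ▸ ⟨b.2, hbc⟩ : (b : G) ∈ (⊥ : Subgroup G))).symm))
  have hdvd' : p ∣ Nat.card (N ⊓ center G : Subgroup G) :=
    (hG.to_subgroup _).card_eq_or_dvd.resolve_left (mt Subgroup.card_eq_one.mp hM)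
  obtain ⟨c, hc⟩ := exists_prime_orderOf_dvd_card' p hdvd'
  exact ⟨c, c.2.1, c.2.2, by rwa [Subgroup.orderOf_coe]⟩

/-- Lift a central element of order `p` of `G ⧸ A` lying in the image of `C`. -/
theorem IsPGroup.exists_mem_central_mod [Finite G] [Fact p.Prime] (hG : IsPGroup p G)
    (A C : Subgroup G) [A.Normal] [C.Normal] (hCA : ¬ C ≤ A) :
    ∃ x ∈ C, x ∉ A ∧ x ^ p ∈ A ∧ ∀ g, g * x * g⁻¹ * x⁻¹ ∈ A := by
  have : (C.map (QuotientGroup.mk' A)).Normal :=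
    Normal.map inferInstance _ (QuotientGroup.mk'_surjective A)
  obtain ⟨q, ⟨x, hxC, rfl⟩, hqc, hq⟩ := (hG.to_quotient A).exists_mem_center_orderOf_eq
    (C.map (QuotientGroup.mk' A)) (by rwa [Ne, Subgroup.map_eq_bot_iff, QuotientGroup.ker_mk'])
  refine ⟨x, hxC, fun hx => ?_, ?_, fun g => ?_⟩
  · rw [show QuotientGroup.mk' A x = 1 from (QuotientGroup.eq_one_iff x).mpr hx, orderOf_one] at hq
    exact (Fact.out : p.Prime).one_lt.ne hq
  · rw [← QuotientGroup.eq_one_iff, QuotientGroup.mk_pow]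
    exact orderOf_dvd_iff_pow_eq_one.mp hq.dvd
  · rw [← QuotientGroup.eq_one_iff]
    have := mem_center_iff.mp hqc (g : G ⧸ A)
    simp only [QuotientGroup.mk_mul, QuotientGroup.mk_inv]
    rw [mul_inv_eq_one, mul_inv_eq_iff_eq_mul]
    exact this

/-! ### Conjugation acting on a cyclic subgroup -/

theorem conj_zpow_of_conj {a x : G} {k : ℤ} (h : x * a * x⁻¹ = a ^ k) (i : ℤ) :
    x * a ^ i * x⁻¹ = a ^ (k * i) := by
  rw [← conj_zpow, h, zpow_mul]

theorem conj_pow_of_conj {a x : G} {k : ℤ} (h : x * a * x⁻¹ = a ^ k) (n : ℕ) :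
    x ^ n * a * (x ^ n)⁻¹ = a ^ k ^ n := by
  induction n with
  | zero => simp
  | succ n ih =>
    rw [pow_succ', pow_succ' k, ← conj_zpow_of_conj h, ← ih]
    group

theorem zpow_mul_pow_of_conj {a x : G} {k : ℤ} (h : x * a * x⁻¹ = a ^ k) (i : ℤ) (n : ℕ) :
    (a ^ i * x) ^ n = a ^ (i * ∑ t ∈ range n, k ^ t) * x ^ n := by
  induction n with
  | zero => simp
  | succ n ih =>
    rw [pow_succ', ih, geom_sum_succ, mul_add, mul_one, zpow_add,
      show i * (k * ∑ t ∈ range n, k ^ t) = k * (i * ∑ t ∈ range n, k ^ t) by ring,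
      ← conj_zpow_of_conj h, pow_succ']
    have : a ^ i * (x * a ^ (i * ∑ t ∈ range n, k ^ t) * x⁻¹) =
      (x * a ^ (i * ∑ t ∈ range n, k ^ t) * x⁻¹) * a ^ i := by
      rw [conj_zpow_of_conj h, ← zpow_add, ← zpow_add, add_comm]
    rw [← this]
    group

/-- If `zpowers a` contains every element of order `p`, then `x ∉ zpowers a` cannot have `x ^ p`
a `p`-th power in `zpowers a` when the geometric sum of the action of `x` is `p` times a unit. -/
theorem not_dvd_of_geom_sum_eq [Fact p.Prime] (hG : IsPGroup p G) {a x : G}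
    (hA : ∀ g : G, g ^ p = 1 → g ∈ zpowers a) (hx : x ∉ zpowers a) {k j w : ℤ}
    (hk : x * a * x⁻¹ = a ^ k) (hj : x ^ p = a ^ j)
    (hs : ∑ t ∈ range p, k ^ t = p * (1 + p * w)) : ¬ (p : ℤ) ∣ j := by
  rintro ⟨j, rfl⟩
  obtain ⟨m, hm⟩ := hG a
  have hm' : a ^ ((p : ℤ) ^ m) = 1 := by exact_mod_cast hm
  obtain ⟨u, v, huv⟩ : IsCoprime (1 + p * w) ((p : ℤ) ^ m) :=
    IsCoprime.pow_right ⟨1, -w, by ring⟩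
  -- `u` inverts `1 + p * w` modulo the order of `a`, so the geometric sum cancels `x ^ p`.
  have h1 : (a ^ (-j * u) * x) ^ p = 1 := by
    rw [zpow_mul_pow_of_conj hk, hs, hj, ← zpow_add,
      show -j * u * (p * (1 + p * w)) + p * j = (p : ℤ) ^ m * (p * j * v) by
        linear_combination (-(p * j)) * huv, zpow_mul, hm', one_zpow]
  exact hx ((mul_mem_cancel_left (zpow_mem_zpowers a _)).mp (hA _ h1))

/-- Otherwise `a ^ j` generates `zpowers a`; as `x` commutes with `x ^ p = a ^ j`, it would
centralize `a`. -/
theorem dvd_of_conj_of_pow_eq [Fact p.Prime] (hG : IsPGroup p G) {a x : G}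
    (hC : ∀ g : G, Commute g a → g ∈ zpowers a) (hx : x ∉ zpowers a) {k j : ℤ}
    (hk : x * a * x⁻¹ = a ^ k) (hj : x ^ p = a ^ j) : (p : ℤ) ∣ j := by
  by_contra hpj
  obtain ⟨m, hm⟩ := (IsPGroup.iff_orderOf.mp hG) a
  have h1 : a ^ (k * j) = a ^ j := by
    rw [← conj_zpow_of_conj hk, ← hj]
    group
  have h2 : ((p ^ m : ℕ) : ℤ) ∣ (k - 1) * j := by
    rw [← hm, orderOf_dvd_iff_zpow_eq_one, sub_mul, zpow_sub, h1, one_mul, mul_inv_cancel]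
  have hcop : IsCoprime ((p ^ m : ℕ) : ℤ) j := by
    push_cast
    exact IsCoprime.pow_left ((Nat.prime_iff_prime_int.mp Fact.out).coprime_iff_not_dvd.mpr hpj)
  have h3 := hcop.dvd_of_dvd_mul_right h2
  rw [← hm, orderOf_dvd_iff_zpow_eq_one, zpow_sub, zpow_one, mul_inv_eq_one, ← hk,
    mul_inv_eq_iff_eq_mul] at h3
  exact hx (hC x h3)

/-- Since `x ^ p` commutes with `a`, `k ^ p ≡ 1` modulo `p`; apply Fermat. -/
theorem prime_dvd_sub_one_of_conj [Fact p.Prime] (hG : IsPGroup p G) {a x : G} (ha : a ≠ 1)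
    {k j : ℤ} (hk : x * a * x⁻¹ = a ^ k) (hj : x ^ p = a ^ j) : (p : ℤ) ∣ k - 1 := by
  have h1 : a ^ (k ^ p) = a := by
    rw [← conj_pow_of_conj hk, hj]
    group
  have h2 : (p : ℤ) ∣ k ^ p - 1 := by
    refine (Int.natCast_dvd_natCast.mpr (hG.dvd_orderOf ha)).trans ?_
    rw [orderOf_dvd_iff_zpow_eq_one, zpow_sub, h1, zpow_one, mul_inv_cancel]
  rw [← ZMod.intCast_zmod_eq_zero_iff_dvd] at h2 ⊢
  push_cast at h2 ⊢
  rwa [ZMod.pow_card] at h2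

theorem exists_geom_sum_eq_of_odd (hp : Odd p) {k : ℤ} (hk : (p : ℤ) ∣ k - 1) :
    ∃ w : ℤ, ∑ t ∈ range p, k ^ t = p * (1 + p * w) := by
  obtain ⟨b, hb⟩ := hk
  obtain ⟨w, hw⟩ := odd_sq_dvd_geom_sum₂_sub (1 : ℤ) b hp
  obtain rfl : k = 1 + p * b := by linarith
  simp only [one_pow, mul_one] at hw
  exact ⟨w, by linear_combination hw⟩

/-- A normal cyclic subgroup of maximal order in a `p`-group with a unique subgroup of order `p`
is self-centralizing. -/
theorem IsPGroup.exists_self_centralizing [Finite G] [Fact p.Prime] (hG : IsPGroup p G)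
    (hU : ∀ g h : G, g ≠ 1 → g ^ p = 1 → h ^ p = 1 → h ∈ zpowers g) :
    ∃ a : G, (zpowers a).Normal ∧ (∀ g : G, g ^ p = 1 → g ∈ zpowers a) ∧
      ∀ g : G, Commute g a → g ∈ zpowers a := by
  have hp : p.Prime := Fact.out
  rcases subsingleton_or_nontrivial G with hs | hn
  · exact ⟨1, by rw [zpowers_one_eq_bot]; infer_instance,
      fun g _ => Subsingleton.elim 1 g ▸ mem_zpowers 1,
      fun g _ => Subsingleton.elim 1 g ▸ mem_zpowers 1⟩
  obtain ⟨a, ha, hmax⟩ := (Set.toFinite {a : G | (zpowers a).Normal}).exists_maximalFor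
    orderOf _ ⟨1, by rw [Set.mem_ofPred, zpowers_one_eq_bot]; infer_instance⟩
  have ha' : (zpowers a).Normal := ha
  have ha1 : a ≠ 1 := by
    rintro rfl
    obtain ⟨z, -, hz, hzp⟩ := hG.exists_mem_center_orderOf_eq ⊤ top_ne_bot
    have := hmax (j := z) (by
      refine ⟨fun n hn g => ?_⟩
      have := mem_center_iff.mp (zpowers_le.mpr hz hn) g
      rwa [this, mul_inv_cancel_right]) (by rw [orderOf_one]; exact orderOf_pos z)
    rw [hzp, orderOf_one] at this
    exact absurd hp.one_lt (not_lt.mpr this)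
  have hA : ∀ g : G, g ^ p = 1 → g ∈ zpowers a := by
    intro g hg
    obtain ⟨n, hn⟩ := hG.dvd_orderOf ha1
    have hn0 : n ≠ 0 := by
      rintro rfl
      exact (orderOf_pos a).ne' hn
    refine (zpowers_le.mpr (npow_mem_zpowers a n)) (hU (a ^ n) g (fun h => ?_) ?_ hg)
    · have := Nat.le_of_dvd (Nat.pos_of_ne_zero hn0) (orderOf_dvd_of_pow_eq_one h)
      rw [hn] at this
      nlinarith [hp.two_le, Nat.pos_of_ne_zero hn0]
    · rw [← pow_mul, mul_comm, ← hn, pow_orderOf_eq_one]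
  refine ⟨a, ha', hA, fun g hg => ?_⟩
  by_contra hga
  obtain ⟨x, hxC, hxA, hxp, hxc⟩ := hG.exists_mem_central_mod (zpowers a)
    (centralizer (zpowers a : Set G))
    (fun h => hga (h (by
      rw [mem_centralizer_iff]
      rintro _ ⟨i, rfl⟩
      exact (hg.zpow_right i).symm)))
  obtain ⟨j, hj⟩ := hxp
  have hxa : x * a * x⁻¹ = a ^ (1 : ℤ) := by
    rw [← mem_centralizer_iff.mp hxC a (mem_zpowers a)]
    group
  -- With trivial action the sum is `p`. Hence `p ∤ j`, so `a` is a power of `x`, and `zpowers x`,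
  -- normal because `x` is central mod `zpowers a`, contradicts maximality.
  have hpj := not_dvd_of_geom_sum_eq hG hA hxA hxa hj.symm (w := 0) (by simp)
  have hax : a ∈ zpowers x := by
    obtain ⟨m, hm⟩ := hG a
    obtain ⟨u, v, huv⟩ : IsCoprime j ((p : ℤ) ^ m) :=
      IsCoprime.pow_right
        ((Nat.prime_iff_prime_int.mp Fact.out).coprime_iff_not_dvd.mpr hpj).symm
    have : a = (x ^ p) ^ u := by
      have hm' : a ^ ((p : ℤ) ^ m) = 1 := by exact_mod_cast hm
      rw [← hj]
      change a = (a ^ j) ^ u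
      rw [← zpow_mul, show j * u = 1 + (p : ℤ) ^ m * (-v) by linear_combination huv,
        zpow_add, zpow_mul, hm', one_zpow, mul_one, zpow_one]
    rw [this]
    exact zpow_mem (npow_mem_zpowers x p) u
  have hle : zpowers a ≤ zpowers x := zpowers_le.mpr hax
  have hxn : (zpowers x).Normal := by
    refine ⟨fun n hn g => ?_⟩
    obtain ⟨i, rfl⟩ := hn
    have : g * x * g⁻¹ ∈ zpowers x := by
      have := mul_mem (hle (hxc g)) (mem_zpowers x)
      rwa [inv_mul_cancel_right] at this
    change g * x ^ i * g⁻¹ ∈ _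
    rw [← conj_zpow]
    exact zpow_mem this i
  have hcard : orderOf x ≤ orderOf a := by
    refine hmax hxn ?_
    rw [← Nat.card_zpowers, ← Nat.card_zpowers]
    exact Nat.card_le_card_of_injective _ (Subgroup.inclusion_injective hle)
  rw [← Nat.card_zpowers, ← Nat.card_zpowers] at hcard
  exact hxA ((Subgroup.eq_of_le_of_card_ge hle hcard) ▸ mem_zpowers x)

/-! ### Recognizing quaternion groups; the case `p = 2` -/

theorem nonempty_mulEquiv_quaternionGroup {n : ℕ} [NeZero n] {a x : G} (ha : orderOf a = 2 * n)
    (hx : x ∉ zpowers a) (hxa : x * a * x⁻¹ = a⁻¹) (hx2 : x ^ 2 = a ^ n)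
    (hG : ∀ g : G, g ∈ zpowers a ∨ x⁻¹ * g ∈ zpowers a) :
    Nonempty (G ≃* QuaternionGroup n) := by
  let φ : ZMod (2 * n) → G := fun i => a ^ (i.cast : ℤ)
  have hφ : ∀ z : ℤ, φ (z : ZMod (2 * n)) = a ^ z := by
    intro z
    rw [zpow_eq_zpow_iff_modEq, ha, ← ZMod.intCast_eq_intCast_iff, ZMod.intCast_zmod_cast]
  have hφ' : Function.Injective φ := by
    intro i j hij
    obtain ⟨i, rfl⟩ := ZMod.intCast_surjective i
    obtain ⟨j, rfl⟩ := ZMod.intCast_surjective j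
    rwa [hφ, hφ, zpow_eq_zpow_iff_modEq, ha, ← ZMod.intCast_eq_intCast_iff] at hij
  have hmem : ∀ i, φ i ∈ zpowers a := fun i => zpow_mem_zpowers a _
  have hcomm : ∀ z : ℤ, a ^ z * x = x * a ^ (-z) := by
    intro z
    have := conj_zpow_of_conj (k := -1) (by rwa [zpow_neg_one]) (-z) (a := a) (x := x)
    rw [neg_one_mul, neg_neg, mul_inv_eq_iff_eq_mul] at this
    exact this.symm
  let f : QuaternionGroup n → G
    | .a i => φ i
    | .xa i => x * φ i
  have hmul : ∀ g h, f (g * h) = f g * f h := by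
    rintro (i | i) (j | j) <;> obtain ⟨i, rfl⟩ := ZMod.intCast_surjective i <;>
      obtain ⟨j, rfl⟩ := ZMod.intCast_surjective j
    · change φ (i + j) = φ i * φ j
      rw [← Int.cast_add, hφ, hφ, hφ, zpow_add]
    · change x * φ (j - i) = φ i * (x * φ j)
      rw [← Int.cast_sub, hφ, hφ, hφ, ← mul_assoc, hcomm, mul_assoc, ← zpow_add, neg_add_eq_sub]
    · change x * φ (i + j) = x * φ i * φ j
      rw [← Int.cast_add, hφ, hφ, hφ, zpow_add, mul_assoc]
    · change φ (n + j - i) = x * φ i * (x * φ j)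
      rw [← Int.cast_natCast n, ← Int.cast_add, ← Int.cast_sub, hφ, hφ, hφ, mul_assoc x,
        ← mul_assoc _ x, hcomm, mul_assoc x, ← mul_assoc x x, ← sq, hx2, ← zpow_add,
        ← zpow_natCast, ← zpow_add]
      congr 1
      ring
  have hbij : Function.Bijective f := by
    constructor
    · rintro (i | i) (j | j) h
      · exact congrArg _ (hφ' h)
      · refine absurd ?_ hx
        exact (mul_mem_cancel_right (hmem j)).mp
          (show x * φ j ∈ zpowers a from (show φ i = x * φ j from h) ▸ hmem i)
      · refine absurd ?_ hx
        exact (mul_mem_cancel_right (hmem i)).mp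
          (show x * φ i ∈ zpowers a from (show x * φ i = φ j from h).symm ▸ hmem j)
      · exact congrArg _ (hφ' (mul_left_cancel h))
    · intro g
      rcases hG g with ⟨z, hz⟩ | ⟨z, hz⟩
      · exact ⟨.a z, (hφ z).trans hz⟩
      · refine ⟨.xa z, ?_⟩
        change x * φ z = g
        rw [hφ]
        change x * (fun z : ℤ => a ^ z) z = g
        rw [hz, mul_inv_cancel_left]
  exact ⟨(MulEquiv.ofBijective (MulHom.mk f hmul) hbij).symm⟩

theorem eq_of_sq_eq_one (hU : ∀ g h : G, g ≠ 1 → g ^ 2 = 1 → h ^ 2 = 1 → h ∈ zpowers g) {g h : G}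
    (hg : g ≠ 1) (hg2 : g ^ 2 = 1) (hh : h ≠ 1) (hh2 : h ^ 2 = 1) : h = g := by
  obtain ⟨i, rfl⟩ := hU g h hg hg2 hh2
  rcases Int.even_or_odd' i with ⟨k, rfl | rfl⟩
  · exact absurd (by simp [zpow_mul, hg2]) hh
  · simp [zpow_add, zpow_mul, hg2]

theorem conj_eq_inv_of_sq_mem (hG : IsPGroup 2 G)
    (hU : ∀ g h : G, g ≠ 1 → g ^ 2 = 1 → h ^ 2 = 1 → h ∈ zpowers g) {a x : G}
    (hN : (zpowers a).Normal)
    (hA : ∀ g : G, g ^ 2 = 1 → g ∈ zpowers a) (hC : ∀ g : G, Commute g a → g ∈ zpowers a)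
    (hx : x ∉ zpowers a) (hx2 : x ^ 2 ∈ zpowers a) :
    x * a * x⁻¹ = a⁻¹ ∧ (x ^ 2) ^ 2 = 1 := by
  have : Fact (Nat.Prime 2) := ⟨Nat.prime_two⟩
  obtain ⟨j, hj⟩ := hx2
  obtain ⟨k, hk⟩ := hN.conj_mem a (mem_zpowers a) x
  replace hj : x ^ 2 = a ^ j := hj.symm
  replace hk : x * a * x⁻¹ = a ^ k := hk.symm
  have ha : a ≠ 1 := by
    rintro rfl
    exact hx (hC x (Commute.one_right x))
  have hjdvd := dvd_of_conj_of_pow_eq hG hC hx hk hj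
  have hkdvd := prime_dvd_sub_one_of_conj hG ha hk hj
  -- If `k ≡ 1` mod 4, then `1 + k` is twice an odd number, which is excluded.
  obtain ⟨u, hu⟩ : ∃ u, k - 1 = 2 * (2 * u + 1) := by
    obtain ⟨v, hv⟩ := hkdvd
    rcases Int.even_or_odd' v with ⟨u, hu | hu⟩
    · refine absurd hjdvd (not_dvd_of_geom_sum_eq hG hA hx hk hj (w := u) ?_)
      simp only [sum_range_succ, range_zero, sum_empty, pow_zero, pow_one]
      push_cast at hv ⊢
      linarith
    · exact ⟨u, by rw [hv, hu]; rfl⟩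
  obtain ⟨m, hm⟩ := IsPGroup.iff_orderOf.mp hG a
  have hred : ∀ i : ℤ, a ^ ((k - 1) * i) = 1 → a ^ (2 * i) = 1 := by
    intro i hi
    rw [← orderOf_dvd_iff_zpow_eq_one, hm] at hi ⊢
    push_cast at hi ⊢
    refine IsCoprime.dvd_of_dvd_mul_left (y := 2 * u + 1) (IsCoprime.pow_left ⟨-u, 1, by ring⟩) ?_
    rwa [show (2 * u + 1) * (2 * i) = (k - 1) * i by rw [hu]; ring]
  have hx4 : (x ^ 2) ^ 2 = 1 := by
    rw [hj, ← zpow_natCast, ← zpow_mul, mul_comm]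
    refine hred j ?_
    rw [sub_mul, zpow_sub, ← conj_zpow_of_conj hk, ← hj, one_mul, ← hj]
    group
  refine ⟨?_, hx4⟩
  have hc2 : (a ^ (k + 1)) ^ 2 = 1 := by
    rw [← zpow_natCast, ← zpow_mul, mul_comm]
    refine hred (k + 1) ?_
    have := conj_pow_of_conj hk 2
    rw [hj] at this
    rw [show (k - 1) * (k + 1) = k ^ 2 - 1 by ring, zpow_sub, ← this]
    group
  have hax : (a ^ (1 : ℤ) * x) ^ 2 = a ^ (k + 1) * x ^ 2 := by
    rw [zpow_mul_pow_of_conj hk]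
    simp [sum_range_succ, add_comm]
  by_cases hc : a ^ (k + 1) = 1
  · rw [hk]
    rw [zpow_add, zpow_one] at hc
    exact eq_inv_of_mul_eq_one_left hc
  -- Both `a ^ (k + 1)` and `x ^ 2` are the unique involution, so `(a * x) ^ 2 = 1`.
  · have := eq_of_sq_eq_one hU (fun h => hx (hA x h)) hx4 hc hc2
    rw [this, ← sq, hx4] at hax
    exact absurd ((mul_mem_cancel_left (zpow_mem_zpowers a 1)).mp (hA _ hax)) hx

/-- Otherwise `y ^ 2` inverts `a`, so `k ^ 2 ≡ -1` modulo the order of `a`, a multiple of 4; but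
`-1` is not a square mod 4. -/
theorem sq_mem_of_pow_four_mem (hG : IsPGroup 2 G)
    (hU : ∀ g h : G, g ≠ 1 → g ^ 2 = 1 → h ^ 2 = 1 → h ∈ zpowers g) {a y : G}
    (hN : (zpowers a).Normal)
    (hA : ∀ g : G, g ^ 2 = 1 → g ∈ zpowers a) (hC : ∀ g : G, Commute g a → g ∈ zpowers a)
    (hy : (y ^ 2) ^ 2 ∈ zpowers a) : y ^ 2 ∈ zpowers a := by
  have : Fact (Nat.Prime 2) := ⟨Nat.prime_two⟩
  by_contra hy2
  obtain ⟨hinv, -⟩ := conj_eq_inv_of_sq_mem hG hU hN hA hC hy2 hy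
  obtain ⟨k, hk⟩ := hN.conj_mem a (mem_zpowers a) y
  replace hk : y * a * y⁻¹ = a ^ k := hk.symm
  have h1 := conj_pow_of_conj hk 2
  rw [hinv, ← zpow_neg_one, eq_comm, ← mul_inv_eq_one, ← zpow_neg, ← zpow_add, neg_neg,
    ← orderOf_dvd_iff_zpow_eq_one] at h1
  obtain ⟨m, hm⟩ := IsPGroup.iff_orderOf.mp hG a
  have ha2 : ¬ orderOf a ∣ 2 := by
    intro h
    rw [orderOf_dvd_iff_pow_eq_one, sq, ← eq_inv_iff_mul_eq_one] at h
    rw [← h, mul_inv_eq_iff_eq_mul] at hinv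
    exact hy2 (hC _ hinv)
  have hm2 : 2 ≤ m := by
    by_contra hm2
    exact ha2 (hm ▸ (pow_dvd_pow 2 (by omega : m ≤ 1)).trans (by norm_num))
  have h4 : (4 : ℤ) ∣ k ^ 2 + 1 := by
    refine dvd_trans ?_ h1
    rw [hm]
    exact_mod_cast pow_dvd_pow 2 hm2
  rcases Int.even_or_odd' k with ⟨v, rfl | rfl⟩
  · ring_nf at h4; omega
  · ring_nf at h4; omega

theorem sq_mem_zpowers (hG : IsPGroup 2 G)
    (hU : ∀ g h : G, g ≠ 1 → g ^ 2 = 1 → h ^ 2 = 1 → h ∈ zpowers g) {a : G}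
    (hN : (zpowers a).Normal)
    (hA : ∀ g : G, g ^ 2 = 1 → g ∈ zpowers a) (hC : ∀ g : G, Commute g a → g ∈ zpowers a)
    (y : G) : y ^ 2 ∈ zpowers a := by
  obtain ⟨n, hn⟩ := hG y
  have : ∀ n, ∀ y : G, y ^ 2 ^ n ∈ zpowers a → y ^ 2 ∈ zpowers a := by
    intro n
    induction n with
    | zero => exact fun y h => pow_mem (by simpa using h) 2
    | succ n ih =>
      intro y h
      rw [pow_succ', pow_mul] at h
      exact sq_mem_of_pow_four_mem hG hU hN hA hC (ih _ h)
  exact this n y (hn ▸ one_mem _)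

/-- A finite `p`-group with a unique subgroup of order `p` is cyclic or generalized quaternion. -/
theorem IsPGroup.isCyclic_or_nonempty_mulEquiv_quaternionGroup [Finite G] [Fact p.Prime]
    (hG : IsPGroup p G) (hU : ∀ g h : G, g ≠ 1 → g ^ p = 1 → h ^ p = 1 → h ∈ zpowers g) :
    IsCyclic G ∨ ∃ n : ℕ, 3 ≤ n ∧ Nonempty (G ≃* QuaternionGroup (2 ^ (n - 2))) := by
  have hp : p.Prime := Fact.out
  obtain ⟨a, hN, hA, hC⟩ := hG.exists_self_centralizing hU
  by_cases htop : (⊤ : Subgroup G) ≤ zpowers a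
  · exact Or.inl ⟨a, fun g => htop (mem_top g)⟩
  right
  obtain ⟨x, -, hx, hxp, -⟩ := hG.exists_mem_central_mod (zpowers a) ⊤ htop
  have ha : a ≠ 1 := by
    rintro rfl
    exact hx (hC x (Commute.one_right x))
  obtain rfl : p = 2 := by
    by_contra hp2
    obtain ⟨j, hj⟩ := hxp
    obtain ⟨k, hk⟩ := hN.conj_mem a (mem_zpowers a) x
    obtain ⟨w, hw⟩ := exists_geom_sum_eq_of_odd (hp.odd_of_ne_two hp2)
      (prime_dvd_sub_one_of_conj hG ha hk.symm hj.symm)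
    exact not_dvd_of_geom_sum_eq hG hA hx hk.symm hj.symm hw
      (dvd_of_conj_of_pow_eq hG hC hx hk.symm hj.symm)
  have hinv : ∀ g, g ∉ zpowers a → g * a * g⁻¹ = a⁻¹ ∧ (g ^ 2) ^ 2 = 1 := fun g hg =>
    conj_eq_inv_of_sq_mem hG hU hN hA hC hg (sq_mem_zpowers hG hU hN hA hC g)
  obtain ⟨hxa, hx4⟩ := hinv x hx
  obtain ⟨m, hm⟩ := IsPGroup.iff_orderOf.mp hG a
  have ha2 : ¬ orderOf a ∣ 2 := by
    intro h
    rw [orderOf_dvd_iff_pow_eq_one, sq, ← eq_inv_iff_mul_eq_one] at h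
    rw [← h, mul_inv_eq_iff_eq_mul] at hxa
    exact hx (hC _ hxa)
  have hm2 : 2 ≤ m := by
    by_contra hm2
    exact ha2 (hm ▸ (pow_dvd_pow 2 (by omega : m ≤ 1)).trans (by norm_num))
  obtain ⟨m, rfl⟩ : ∃ l, m = l + 1 := ⟨m - 1, by omega⟩
  refine ⟨m + 2, by omega, ?_⟩
  rw [Nat.add_sub_cancel]
  have ham : orderOf a = 2 * 2 ^ m := by rw [hm, pow_succ']
  refine nonempty_mulEquiv_quaternionGroup ham hx hxa ?_ fun g => ?_
  · refine eq_of_sq_eq_one hU (fun h => ?_) ?_ (fun h => hx (hA x h)) hx4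
    · have := Nat.le_of_dvd (by positivity) (orderOf_dvd_of_pow_eq_one h)
      have : 0 < 2 ^ m := by positivity
      omega
    · rw [← pow_mul, mul_comm, ← ham, pow_orderOf_eq_one]
  -- Both `g` and `x` invert `a`, so `x⁻¹ * g` centralizes it.
  · refine or_iff_not_imp_left.mpr fun hg => hC _ ?_
    have h1 := (hinv g hg).1
    rw [← hxa] at h1
    have h2 : x⁻¹ * (g * a * g⁻¹) * g = x⁻¹ * (x * a * x⁻¹) * g := by rw [h1]
    change x⁻¹ * g * a = a * (x⁻¹ * g)
    calc x⁻¹ * g * a = x⁻¹ * (g * a * g⁻¹) * g := by group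
      _ = _ := by rw [h2]; group

/-! ### From breaking points to unique subgroups of order `p`, and back -/

theorem mem_zpowers_symm_of_orderOf_prime [Fact p.Prime] {u v : G} (hu : orderOf u = p)
    (hv : v ≠ 1) (hvu : v ∈ zpowers u) : u ∈ zpowers v := by
  have hp : p.Prime := Fact.out
  obtain ⟨i, rfl⟩ := hvu
  have hi : ¬ (p : ℤ) ∣ i := by rwa [← hu, orderOf_dvd_iff_zpow_eq_one]
  obtain ⟨r, s, hrs⟩ := (Nat.prime_iff_prime_int.mp hp).coprime_iff_not_dvd.mpr hi
  refine ⟨s, ?_⟩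
  change (u ^ i) ^ s = u
  rw [← zpow_mul, show i * s = 1 + p * (-r) by linear_combination hrs, zpow_add, zpow_mul u p,
    zpow_natCast, ← hu, pow_orderOf_eq_one, one_zpow, mul_one, zpow_one]

theorem mem_zpowers_pow_of_pow_eq_one [Fact p.Prime] {h g : G} {s : ℕ}
    (hh : orderOf h = p ^ (s + 1)) (hg : g ∈ zpowers h) (hgp : g ^ p = 1) :
    g ∈ zpowers (h ^ p ^ s) := by
  obtain ⟨i, rfl⟩ := hg
  change (h ^ i) ^ p = 1 at hgp
  rw [← zpow_natCast, ← zpow_mul, ← orderOf_dvd_iff_zpow_eq_one, hh] at hgp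
  push_cast at hgp
  rw [pow_succ, mul_dvd_mul_iff_right (by exact_mod_cast (Fact.out : p.Prime).ne_zero)] at hgp
  obtain ⟨j, rfl⟩ := hgp
  refine ⟨j, ?_⟩
  change (h ^ p ^ s) ^ j = h ^ ((p : ℤ) ^ s * j)
  rw [zpow_mul, ← Nat.cast_pow, zpow_natCast]

theorem orderOf_pow_prime_pow [Fact p.Prime] {h : G} {s : ℕ} (hh : orderOf h = p ^ (s + 1)) :
    orderOf (h ^ p ^ s) = p := by
  have hp : p.Prime := Fact.out
  rw [orderOf_pow_of_dvd (pow_ne_zero _ hp.ne_zero) (hh ▸ pow_dvd_pow p s.le_succ), hh,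
    pow_succ, Nat.mul_div_cancel_left _ (pow_pos hp.pos s)]

theorem IsPGroup.exists_orderOf_eq_prime_pow_succ [Fact p.Prime] (hG : IsPGroup p G) {g : G}
    (hg : g ≠ 1) : ∃ s, orderOf g = p ^ (s + 1) := by
  obtain ⟨k, hk⟩ := IsPGroup.iff_orderOf.mp hG g
  cases k with
  | zero => exact absurd (orderOf_eq_one_iff.mp hk) hg
  | succ s => exact ⟨s, hk⟩

/-- An element outside a proper subgroup can be chosen of prime power order. -/
theorem exists_notMem_orderOf_eq_prime_pow [Finite G] {H : Subgroup G} (hH : H ≠ ⊤) :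
    ∃ g ∉ H, ∃ p k : ℕ, p.Prime ∧ orderOf g = p ^ k := by
  -- By minimality `g ^ q ∈ H` for each prime `q` dividing the order; two such primes would give `g
  -- ∈ H` by Bézout.
  obtain ⟨g, hg, hmin⟩ := (Set.toFinite {g : G | g ∉ H}).exists_minimalFor orderOf _
    (by
      by_contra hne
      exact hH (eq_top_iff.mpr fun g _ => by_contra fun hg => hne ⟨g, hg⟩))
  have hgH : g ∉ H := hg
  have hg1 : orderOf g ≠ 1 := fun h => hgH (orderOf_eq_one_iff.mp h ▸ one_mem H)
  have hpow : ∀ q : ℕ, q.Prime → q ∣ orderOf g → g ^ q ∈ H := by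
    intro q hq hqg
    by_contra hn
    have hlt : orderOf (g ^ q) < orderOf g := by
      rw [orderOf_pow_of_dvd hq.ne_zero hqg]
      exact Nat.div_lt_self (orderOf_pos g) hq.one_lt
    exact hlt.not_ge (hmin hn hlt.le)
  refine ⟨g, hgH, (orderOf g).minFac, _, Nat.minFac_prime hg1,
    Nat.eq_prime_pow_of_unique_prime_dvd (orderOf_pos g).ne' fun {q} hq hqg => ?_⟩
  by_contra hne
  obtain ⟨u, v, huv⟩ :=
    Nat.isCoprime_iff_coprime.mpr ((Nat.coprime_primes hq (Nat.minFac_prime hg1)).mpr hne)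
  have hmem := mul_mem (zpow_mem (hpow q hq hqg) u)
    (zpow_mem (hpow _ (Nat.minFac_prime hg1) (Nat.minFac_dvd _)) v)
  rw [← zpow_natCast, ← zpow_mul, ← zpow_natCast, ← zpow_mul, ← zpow_add, mul_comm, mul_comm _ v,
    huv, zpow_one] at hmem
  exact hgH hmem

/-- An element of `p`-power order outside `zpowers h` has `h` among its powers, so `h` has `p`-power
order. An element of another prime order `q` could then neither lie in `zpowers h` nor generate `h`.
-/
theorem exists_isPGroup_of_forall_notMem [Finite G] {h : G} (h1 : h ≠ 1) (htop : zpowers h ≠ ⊤)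
    (hcomp : ∀ g, g ∉ zpowers h → h ∈ zpowers g) : ∃ p : ℕ, p.Prime ∧ IsPGroup p G := by
  obtain ⟨g, hg, p, k, hp, hk⟩ := exists_notMem_orderOf_eq_prime_pow htop
  have hhp : orderOf h ∣ p ^ k := hk ▸ orderOf_dvd_of_mem_zpowers (hcomp g hg)
  refine ⟨p, hp, IsPGroup.of_card (n := (Nat.card G).primeFactorsList.length)
    (Nat.eq_prime_pow_of_unique_prime_dvd Nat.card_pos.ne' fun {q} hq hqG => ?_)⟩
  by_contra hne
  have : Fact q.Prime := ⟨hq⟩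
  obtain ⟨y, hy⟩ := exists_prime_orderOf_dvd_card' q hqG
  have hcop : Nat.Coprime q (p ^ k) := ((Nat.coprime_primes hq hp).mpr hne).pow_right k
  have hyh : y ∉ zpowers h := fun hm => hq.one_lt.ne' (Nat.eq_one_of_dvd_coprimes hcop dvd_rfl
    (hy ▸ (orderOf_dvd_of_mem_zpowers hm).trans hhp))
  exact h1 (orderOf_eq_one_iff.mp (Nat.eq_one_of_dvd_coprimes hcop
    (hy ▸ orderOf_dvd_of_mem_zpowers (hcomp y hyh)) hhp))

/-- The element `h ^ p ^ s` of order `p` is a power of every element of order `p`, inside `zpowers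
h` or not. -/
theorem mem_zpowers_of_forall_notMem [Fact p.Prime] (hG : IsPGroup p G) {h : G} (h1 : h ≠ 1)
    (hcomp : ∀ g, g ∉ zpowers h → h ∈ zpowers g) (g g' : G) (hg : g ≠ 1) (hgp : g ^ p = 1)
    (hgp' : g' ^ p = 1) : g' ∈ zpowers g := by
  obtain ⟨s, hs⟩ := hG.exists_orderOf_eq_prime_pow_succ h1
  have hz := orderOf_pow_prime_pow hs
  have hz1 : h ^ p ^ s ≠ 1 :=
    fun h => (Fact.out : p.Prime).one_lt.ne (by rwa [h, orderOf_one] at hz)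
  have key : ∀ u : G, u ≠ 1 → u ^ p = 1 → h ^ p ^ s ∈ zpowers u := by
    intro u hu hup
    by_cases huh : u ∈ zpowers h
    · exact mem_zpowers_symm_of_orderOf_prime hz hu (mem_zpowers_pow_of_pow_eq_one hs huh hup)
    · exact pow_mem (hcomp u huh) _
  by_cases hg1 : g' = 1
  · exact hg1 ▸ one_mem _
  exact zpowers_le.mpr (key g hg hgp) (mem_zpowers_symm_of_orderOf_prime
    (orderOf_eq_prime hgp' hg1) hz1 (key g' hg1 hgp'))

theorem exists_isBreakingPoint_of_orderOf_prime [Fact p.Prime] (hG : IsPGroup p G) {z : G}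
    (hz : orderOf z = p) (hcard : Nat.card G ≠ p)
    (hmem : ∀ g : G, g ≠ 1 → g ^ p = 1 → z ∈ zpowers g) :
    ∃ H : CyclicSubgroups G, IsBreakingPoint H := by
  refine ⟨⟨zpowers z, inferInstance⟩, ?_, ?_, ?_⟩
  · rw [zpowers_ne_bot]
    rintro rfl
    exact (Fact.out : p.Prime).one_lt.ne (by rwa [orderOf_one] at hz)
  · intro h
    change zpowers z = ⊤ at h
    rw [← hz, ← Nat.card_zpowers, h, card_top] at hcard
    exact hcard rfl
  · rintro ⟨X, hX⟩
    obtain ⟨g, rfl⟩ := (Subgroup.isCyclic_iff_exists_zpowers_eq_top X).mp hX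
    by_cases hg : g = 1
    · left
      change zpowers g ≤ zpowers z
      rw [hg, zpowers_one_eq_bot]
      exact bot_le
    right
    obtain ⟨s, hs⟩ := hG.exists_orderOf_eq_prime_pow_succ hg
    have ho := orderOf_pow_prime_pow hs
    change zpowers z ≤ zpowers g
    refine zpowers_le.mpr (zpowers_le.mpr (npow_mem_zpowers g (p ^ s)) (hmem _ (fun h => ?_) ?_))
    · exact (Fact.out : p.Prime).one_lt.ne (by rwa [h, orderOf_one] at ho)
    · exact orderOf_dvd_iff_pow_eq_one.mp ho.dvd

theorem QuaternionGroup.eq_a_of_sq_eq_one {n : ℕ} [NeZero n] {q : QuaternionGroup n} (hq : q ≠ 1)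
    (hq2 : q ^ 2 = 1) : q = a n := by
  rcases q with i | i
  · congr 1
    rw [sq, a_mul_a, one_def, a.injEq] at hq2
    rw [Ne, one_def, a.injEq] at hq
    have hi := ZMod.natCast_zmod_val i
    have hlt := ZMod.val_lt i
    rw [← hi, ← Nat.cast_add, ZMod.natCast_eq_zero_iff, ← two_mul,
      Nat.mul_dvd_mul_iff_left two_pos] at hq2
    obtain ⟨c, hc⟩ := hq2
    have hc0 : c ≠ 0 := by
      rintro rfl
      exact hq (by rw [← hi, hc]; simp)
    have hc2 : c < 2 := by
      rw [hc, mul_comm] at hlt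
      exact Nat.lt_of_mul_lt_mul_right hlt
    obtain rfl : c = 1 := by omega
    rw [← hi, hc, mul_one]
  · exfalso
    have h4 := orderOf_xa i
    have := Nat.le_of_dvd two_pos (orderOf_dvd_of_pow_eq_one hq2)
    omega

theorem QuaternionGroup.orderOf_a_natCast {n : ℕ} [NeZero n] :
    orderOf (a n : QuaternionGroup n) = 2 := by
  rw [← a_one_pow, orderOf_pow_of_dvd (NeZero.ne n) (by simp), orderOf_a_one,
    Nat.mul_div_cancel _ (NeZero.pos n)]

end

open Subgroup in
theorem theorem1p1 (G : Type*) [Group G] [Finite G] :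
    (∃ H : CyclicSubgroups G, IsBreakingPoint H) ↔
      (IsCyclic G ∧ ∃ p : ℕ, p.Prime ∧ IsPGroup p G ∧ p ^ 2 ≤ Nat.card G) ∨
        IsGeneralizedQuaternionTwoGroup G := by
  constructor
  · rintro ⟨⟨H, hH⟩, hbot, htop, hcomp⟩
    obtain ⟨h, rfl⟩ := (Subgroup.isCyclic_iff_exists_zpowers_eq_top H).mp hH
    change zpowers h ≠ ⊥ at hbot
    change zpowers h ≠ ⊤ at htop
    have h1 : h ≠ 1 := zpowers_ne_bot.mp hbot
    have hcomp' : ∀ g, g ∉ zpowers h → h ∈ zpowers g := fun g hg =>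
      ((hcomp ⟨zpowers g, inferInstance⟩).resolve_left fun hle => hg (hle (mem_zpowers g)))
        (mem_zpowers h)
    obtain ⟨p, hp, hG⟩ := exists_isPGroup_of_forall_notMem h1 htop hcomp'
    have : Fact p.Prime := ⟨hp⟩
    refine (hG.isCyclic_or_nonempty_mulEquiv_quaternionGroup
      (mem_zpowers_of_forall_notMem hG h1 hcomp')).imp_left fun hc => ⟨hc, p, hp, hG, ?_⟩
    obtain ⟨s, hs⟩ := hG.exists_orderOf_eq_prime_pow_succ h1
    obtain ⟨m, hm⟩ := IsPGroup.iff_card.mp hG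
    have hlt : p ^ (s + 1) < p ^ m := by
      rw [← hs, ← hm, ← Nat.card_zpowers]
      exact lt_of_le_of_ne (card_le_card_group _) fun h => htop (eq_top_of_card_eq _ h)
    rw [hm]
    have := (Nat.pow_lt_pow_iff_right hp.one_lt).mp hlt
    exact Nat.pow_le_pow_right hp.pos (by omega)
  · rintro (⟨⟨h, hh⟩, p, hp, hG, hcard⟩ | ⟨n, hn, ⟨e⟩⟩)
    · have : Fact p.Prime := ⟨hp⟩
      have hlt : p < Nat.card G := by nlinarith [hp.one_lt]
      have h1 : h ≠ 1 := by
        rintro rfl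
        have : Nat.card G = 1 := by
          rw [← orderOf_eq_card_of_forall_mem_zpowers hh, orderOf_one]
        exact absurd hp.one_lt (by omega)
      obtain ⟨s, hs⟩ := hG.exists_orderOf_eq_prime_pow_succ h1
      exact exists_isBreakingPoint_of_orderOf_prime hG (orderOf_pow_prime_pow hs) hlt.ne'
        fun g hg hgp => mem_zpowers_symm_of_orderOf_prime (orderOf_pow_prime_pow hs) hg
          (mem_zpowers_pow_of_pow_eq_one hs (hh g) hgp)
    · have hcard : Nat.card G = 2 ^ n := by
        rw [Nat.card_congr e.toEquiv, Nat.card_eq_fintype_card, QuaternionGroup.card,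
          show 4 = 2 ^ 2 by norm_num, ← pow_add, Nat.add_sub_cancel' (by omega)]
      refine exists_isBreakingPoint_of_orderOf_prime (p := 2) (z := e.symm (.a (2 ^ (n - 2) : ℕ)))
        (IsPGroup.of_card hcard) ?_ ?_ fun g hg hg2 => ?_
      · rw [MulEquiv.orderOf_eq, QuaternionGroup.orderOf_a_natCast]
      · rw [hcard]
        exact (lt_self_pow₀ one_lt_two (by omega)).ne'
      · rw [← QuaternionGroup.eq_a_of_sq_eq_one (q := e g) (by simpa using hg)
          (by rw [← map_pow, hg2, map_one]), e.symm_apply_apply]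
        exact mem_zpowers g
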